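/- Let $\mathcal H$ and $\mathcal G$ be real Hilbert spaces, let $L\colon\mathcal H\to\mathcal G$ be a bounded linear operator with $0<\|L\|\le 1$, let $B\colon\mathcal G\to 2^{\mathcal G}$ be maximally monotone, and let $\gamma\in\,]0,+\infty[$. Suppose that $B$ is uniformly monotone with modulus $\phi\colon[0,+\infty[\,\to[0,+\infty]$, i.e., $\phi$ is increasing (in the wide sense), vanishes only at $0$, and $$\langle y_1-y_2,\,y_1^*-y_2^*\rangle_{\mathcal G}\ \ge\ \phi(\|y_1-y_2\|_{\mathcal G})\qquad\text{for all }(y_1,y_1^*),(y_2,y_2^*)\in\operatorname{gra}B .$$ The resolvent composition of $B$ and $L$ with parameter $\gamma$ is the set-valued operator $L\triangleleft_\gamma B\colon\mathcal H\to2^{\mathcal H}$ given by $$L\triangleleft_\gamma B=\bigl(L^*\circ(B+\gamma^{-1}\mathrm{Id}_{\mathcal G})^{-1}\circ L\bigr)^{-1}-\gamma^{-1}\mathrm{Id}_{\mathcal H}.$$ For a proper function $g\colon\mathcal G\to\,]-\infty,+\infty]$ that has a continuous affine minorant, and for $\rho>0$, the proximal composition of $g$ and $L$ with parameter $\rho$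 is $$L\triangleleft_\rho g=(h\circ L)^*-\frac1{2\rho}\|\cdot\|_{\mathcal H}^2,\qquad h(y)=\inf_{z\in\mathcal G}\Bigl(g^*(z)+\frac{\rho}{2}\|y-z\|_{\mathcal G}^2\Bigr),$$ where $f^*(x^*)=\sup_x(\langle x,x^*\rangle-f(x))$ denotes the Legendre conjugate of $f$ (so $h$ is the Moreau envelope of $g^*$ of parameter $1/\rho$). Set $\phi_L=L\triangleleft_{\gamma/2}(\phi\circ\|\cdot\|_{\mathcal G})$. Then $$\langle x_1-x_2,\,x_1^*-x_2^*\rangle_{\mathcal H}\ \ge\ \phi_L(x_1-x_2)\qquad\text{for all }(x_1,x_1^*),(x_2,x_2^*)\in\operatorname{gra}(L\triangleleft_\gamma B).$$ -/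

import Mathlib

open scoped NNReal ENNReal

noncomputable section

namespace ResolventComposition

/-- The inverse of a set-valued operator. -/
def inverse {X Y : Type*} (A : X → Set Y) : Y → Set X :=
  fun y => {x | y ∈ A x}

section Operators

variable {H G : Type*}
  [NormedAddCommGroup H] [InnerProductSpace ℝ H] [CompleteSpace H]
  [NormedAddCommGroup G] [InnerProductSpace ℝ G] [CompleteSpace G]

/-- The operator `A + c Id`. -/
def addSmulId (A : H → Set H) (c : ℝ) : H → Set H :=
  fun x => {u | ∃ a ∈ A x, u = a + c • x}

/-- A set-valued operator is monotone if `⟪x₁ - x₂, u₁ - u₂⟫ ≥ 0` for all `(x₁, u₁)` and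
`(x₂, u₂)` in its graph. -/
def IsMonotone (A : H → Set H) : Prop :=
  ∀ x₁, ∀ u₁ ∈ A x₁, ∀ x₂, ∀ u₂ ∈ A x₂, 0 ≤ inner ℝ (x₁ - x₂) (u₁ - u₂)

/-- A set-valued operator is maximally monotone if it is monotone and no monotone operator has a
graph that properly contains its graph. -/
def IsMaximallyMonotone (A : H → Set H) : Prop :=
  IsMonotone A ∧ ∀ A' : H → Set H, IsMonotone A' → (∀ x, A x ⊆ A' x) → A' = A

/-- `A` is uniformly monotone with modulus `φ : [0, +∞[ → [0, +∞]`: the function `φ` is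
increasing, vanishes only at `0`, and `⟪x₁ - x₂, u₁ - u₂⟫ ≥ φ(‖x₁ - x₂‖)` for all `(x₁, u₁)` and
`(x₂, u₂)` in the graph of `A`. -/
structure IsUniformlyMonotone (A : H → Set H) (φ : ℝ≥0 → ℝ≥0∞) : Prop where
  monotone : Monotone φ
  eq_zero_iff : ∀ t, φ t = 0 ↔ t = 0
  le_inner : ∀ x₁, ∀ u₁ ∈ A x₁, ∀ x₂, ∀ u₂ ∈ A x₂,
    (φ ‖x₁ - x₂‖₊ : EReal) ≤ ((inner ℝ (x₁ - x₂) (u₁ - u₂) : ℝ) : EReal)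

/-- The parallel composition `(M ∘ B⁻¹ ∘ M*)⁻¹` of `B : G → 2^G` by `M : G → H`. -/
def parallelComposition (M : G →L[ℝ] H) (B : G → Set G) : H → Set H :=
  inverse fun u => M '' inverse B (ContinuousLinearMap.adjoint M u)

/-- The resolvent composition of `B` and `L` with parameter `γ`: the parallel composition of
`B + γ⁻¹ Id` by `L*`, minus `γ⁻¹ Id`. -/
def resolventComposition (L : H →L[ℝ] G) (γ : ℝ) (B : G → Set G) : H → Set H :=
  addSmulId (parallelComposition (ContinuousLinearMap.adjoint L) (addSmulId B γ⁻¹)) (-γ⁻¹)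

/-- The Legendre conjugate `f*(u) = sup_x (⟪x, u⟫ - f(x))`. -/
def conjugate (f : H → EReal) : H → EReal :=
  fun u => ⨆ x, (((inner ℝ x u : ℝ) : EReal) - f x)

/-- The Moreau envelope of `f` of parameter `γ`: `x ↦ inf_y (f(y) + ‖x - y‖² / (2γ))`. -/
def moreauEnvelope (γ : ℝ) (f : H → EReal) : H → EReal :=
  fun x => ⨅ y, (f y + ((1 / (2 * γ) * ‖x - y‖ ^ 2 : ℝ) : EReal))

/-- The proximal composition of `g` and `L` with parameter `γ`: the conjugate of `h ∘ L`, where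
`h` is the Moreau envelope of `g*` of parameter `1/γ`, minus `‖·‖² / (2γ)`. -/
def proximalComposition (L : H →L[ℝ] G) (γ : ℝ) (g : G → EReal) : H → EReal :=
  fun x => conjugate (fun z => moreauEnvelope (1 / γ) (conjugate g) (L z)) x
    - ((1 / (2 * γ) * ‖x‖ ^ 2 : ℝ) : EReal)

end Operators

end ResolventComposition

end

namespace ResolventComposition

section

variable {H G : Type*}
  [NormedAddCommGroup H] [InnerProductSpace ℝ H] [CompleteSpace H]
  [NormedAddCommGroup G] [InnerProductSpace ℝ G] [CompleteSpace G]

/-! Graph points have `x = L* y` with `L (u + γ⁻¹ x) - γ⁻¹ y ∈ B y`. For differences `x`, `u`, `y`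
of two such points, uniform monotonicity of `B` reads `φ ‖y‖ + γ⁻¹‖y‖² - γ⁻¹‖x‖² ≤ ⟪x, u⟫`. By
Fenchel–Young, the left side dominates the proximal composition at `x = L* y`
(`proximalComposition_adjoint_le`). -/

/-- Points of the graph of the resolvent composition come from points of the graph of `B`. -/
lemma exists_of_mem_resolventComposition {L : H →L[ℝ] G} {γ : ℝ} {B : G → Set G} {x u : H}
    (hu : u ∈ resolventComposition L γ B x) :
    ∃ y, ContinuousLinearMap.adjoint L y = x ∧ L (u + γ⁻¹ • x) - γ⁻¹ • y ∈ B y := by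
  obtain ⟨a, ⟨y, ⟨b, hb, hab⟩, hy⟩, rfl⟩ := hu
  rw [ContinuousLinearMap.adjoint_adjoint] at hab
  refine ⟨y, hy, ?_⟩
  have : L (a + (-γ⁻¹) • x + γ⁻¹ • x) - γ⁻¹ • y = b := by simp [hab]
  rwa [this]

/-- A quadratic Fenchel–Young inequality. -/
lemma inner_le_quadratic {ρ : ℝ} (hρ : 0 < ρ) (y w : G) :
    inner ℝ y w ≤ 1 / (2 * ρ) * ‖y‖ ^ 2 + ρ / 2 * ‖w‖ ^ 2 := by
  have h := real_inner_le_norm y w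
  have h2 : 1 / (2 * ρ) * ‖y‖ ^ 2 + ρ / 2 * ‖w‖ ^ 2 - ‖y‖ * ‖w‖
      = 1 / (2 * ρ) * (‖y‖ - ρ * ‖w‖) ^ 2 := by
    field_simp
    ring
  have h3 : 0 ≤ 1 / (2 * ρ) * (‖y‖ - ρ * ‖w‖) ^ 2 := by positivity
  linarith

/-- A lower bound on the Moreau envelope of a conjugate. -/
lemma le_moreauEnvelope_conjugate {ρ : ℝ} (hρ : 0 < ρ) {g : G → EReal} {y : G} {r : ℝ}
    (hr : g y = r) (w : G) :
    ((inner ℝ y w - r - 1 / (2 * ρ) * ‖y‖ ^ 2 : ℝ) : EReal)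
      ≤ moreauEnvelope (1 / ρ) (conjugate g) w := by
  refine le_iInf fun v => ?_
  have h1 : ((inner ℝ y v - r : ℝ) : EReal) ≤ conjugate g v := by
    refine le_trans ?_ (le_iSup (fun x => ((inner ℝ x v : ℝ) : EReal) - g x) y)
    simp [hr]
  refine le_trans ?_ (add_le_add_left h1 _)
  rw [← EReal.coe_add, EReal.coe_le_coe_iff]
  have h2 := inner_le_quadratic hρ y (w - v)
  have h3 : 1 / (2 * (1 / ρ)) = ρ / 2 := by field_simp
  rw [inner_sub_right] at h2
  rw [h3]
  linarith

/-- An upper bound on the proximal composition at the points of the range of `L*`. -/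
lemma proximalComposition_adjoint_le (L : H →L[ℝ] G) {ρ : ℝ} (hρ : 0 < ρ) {g : G → EReal}
    {y : G} {r : ℝ} (hr : g y = r) :
    proximalComposition L ρ g (ContinuousLinearMap.adjoint L y)
      ≤ ((r + 1 / (2 * ρ) * ‖y‖ ^ 2
          - 1 / (2 * ρ) * ‖ContinuousLinearMap.adjoint L y‖ ^ 2 : ℝ) : EReal) := by
  rw [EReal.coe_sub]
  refine EReal.sub_le_sub (iSup_le fun z => ?_) le_rfl
  -- The terms `⟪z, L* y⟫` and `⟪y, L z⟫` cancel, so the bound is independent of `z`.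
  refine (EReal.sub_le_sub le_rfl (le_moreauEnvelope_conjugate hρ hr (L z))).trans ?_
  rw [← EReal.coe_sub, EReal.coe_le_coe_iff, ContinuousLinearMap.adjoint_inner_right,
    real_inner_comm]
  linarith

end

end ResolventComposition

theorem mainTheorem10 {H G : Type*}
    [NormedAddCommGroup H] [InnerProductSpace ℝ H] [CompleteSpace H]
    [NormedAddCommGroup G] [InnerProductSpace ℝ G] [CompleteSpace G]
    (L : H →L[ℝ] G) (hL_pos : 0 < ‖L‖) (hL_le : ‖L‖ ≤ 1)
    (B : G → Set G) (hB : ResolventComposition.IsMaximallyMonotone B)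
    (γ : ℝ) (hγ : 0 < γ)
    (φ : ℝ≥0 → ℝ≥0∞) (hφ : ResolventComposition.IsUniformlyMonotone B φ) :
    ∀ x₁, ∀ u₁ ∈ ResolventComposition.resolventComposition L γ B x₁,
    ∀ x₂, ∀ u₂ ∈ ResolventComposition.resolventComposition L γ B x₂,
      ResolventComposition.proximalComposition L (γ / 2) (fun y : G => (φ ‖y‖₊ : EReal)) (x₁ - x₂)
        ≤ ((inner ℝ (x₁ - x₂) (u₁ - u₂) : ℝ) : EReal) := by
  intro x₁ u₁ h₁ x₂ u₂ h₂
  obtain ⟨y₁, hx₁, hy₁⟩ := ResolventComposition.exists_of_mem_resolventComposition h₁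
  obtain ⟨y₂, hx₂, hy₂⟩ := ResolventComposition.exists_of_mem_resolventComposition h₂
  have hx : ContinuousLinearMap.adjoint L (y₁ - y₂) = x₁ - x₂ := by rw [map_sub, hx₁, hx₂]
  have hmono := hφ.le_inner _ _ hy₁ _ _ hy₂
  -- The modulus is finite here, being bounded by a real inner product.
  obtain ⟨r, hr⟩ : ∃ r : ℝ, (φ ‖y₁ - y₂‖₊ : EReal) = r :=
    ⟨_, (EReal.coe_toReal (ne_top_of_le_ne_top (EReal.coe_ne_top _) hmono)
      (EReal.coe_ennreal_ne_bot _)).symm⟩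
  rw [hr, EReal.coe_le_coe_iff] at hmono
  have key := ResolventComposition.proximalComposition_adjoint_le L (half_pos hγ)
    (g := fun y : G => (φ ‖y‖₊ : EReal)) hr
  rw [hx] at key
  refine key.trans ?_
  rw [EReal.coe_le_coe_iff]
  have hsub : L (u₁ + γ⁻¹ • x₁) - γ⁻¹ • y₁ - (L (u₂ + γ⁻¹ • x₂) - γ⁻¹ • y₂)
      = L ((u₁ - u₂) + γ⁻¹ • (x₁ - x₂)) - γ⁻¹ • (y₁ - y₂) := by
    simp only [map_add, map_sub, map_smul, smul_sub]
    abel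
  rw [hsub, inner_sub_right, ← ContinuousLinearMap.adjoint_inner_left, hx, inner_add_right,
    inner_smul_right, inner_smul_right, real_inner_self_eq_norm_sq,
    real_inner_self_eq_norm_sq] at hmono
  -- The parameter `γ / 2` makes the quadratic terms match those from the resolvent.
  have hc : 1 / (2 * (γ / 2)) = γ⁻¹ := by field_simp
  rw [hc]
  linarith
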